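/- Fix $\Delta\tau>0$. A Brownian bridge over $[0,\Delta\tau]$ from $p$ to $q$ in $\mathbb R^d$ is a Gaussian process $(B(t))_{0\le t\le\Delta\tau}$ with almost surely continuous paths, mean $\mathbb E[B(t)]=p+\frac{t}{\Delta\tau}(q-p)$ and covariance $\mathrm{Cov}(B(s),B(t))=\frac{s(\Delta\tau-t)}{\Delta\tau}I_d$ for $0\le s\le t\le\Delta\tau$. (i) Let $0<a<x$, let $B$ be a one-dimensional Brownian bridge from $0$ to $x$ over $[0,\Delta\tau]$, and let $T_a=\inf\{t>0: B(t)>a\}$ be its first passage time over the barrier $a$. Then $T_a$ is integrable and $$\frac{1}{1+\Delta\tau/x^{2}}\;\le\;\frac{\mathbb E[T_a]}{\frac ax\,\Delta\tau}\;\le\;1 .$$ Consequently, for fixed $a$ and $x$, $\mathbb E[T_a]\big/\big(\frac ax\Delta\tau\big)\to1$ as $\Delta\tau\to0^+$. (ii) Let $\Omega\subset\mathbb R^d$ be an open half-space (so that $\partial\Omega$ is a hyperplane), let $\rho=\rho_{\partial\Omega}$ be the signed distance to $\partial\Omega$, negative in $\Omega$ and nonnegative outside $\Omega$, and let $B_{\rm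 old}\in\Omega$ and $B_{\rm new}\notin\Omega$. Put $$\Delta\rho=\rho(B_{\rm new})-\rho(B_{\rm old}),\qquad \lambda=\frac{|\rho(B_{\rm new})|}{|\rho(B_{\rm old})|+|\rho(B_{\rm new})|}.$$ Let $B$ be a $d$-dimensional Brownian bridge from $B_{\rm old}$ to $B_{\rm new}$ over $[0,\Delta\tau]$, and let $T=\inf\{t>0:B(t)\notin\Omega\}$ be its exit time from $\Omega$. Then $T$ is integrable and $$\frac{1}{1+\Delta\tau\,(\Delta\rho)^{-2}}\;\le\;\frac{\mathbb E[T]}{(1-\lambda)\,\Delta\tau}\;\le\;1 .$$ Consequently, for fixed $\Omega$, $B_{\rm old}$ and $B_{\rm new}$, $\mathbb E[T]\sim(1-\lambda)\Delta\tau$ as $\Delta\tau\to0^+$, that is, $\mathbb E[T]\big/\big((1-\lambda)\Delta\tau\big)\to1$. -/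

import Mathlib

open MeasureTheory ProbabilityTheory Set Filter Topology

noncomputable section

/-- The process `B`, observed on the time interval `[0, τ]`, is a (standard) Brownian bridge from
`p` to `q` over time `τ` in the Euclidean space `E`: a Gaussian process with almost surely
continuous paths, whose mean interpolates linearly between `p` and `q` and whose covariance is
`s (τ - t) / τ` times the identity for `s ≤ t`. For `E = ℝ` the inner products are products of
real numbers, and the last condition reads `cov (B s) (B t) = s (τ - t) / τ`.
Values of `B` at times outside `[0, τ]` play no role. -/
structure IsBrownianBridge {E S : Type*} [NormedAddCommGroup E] [InnerProductSpace ℝ E]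
    [MeasurableSpace E] [MeasurableSpace S] (B : ℝ → S → E) (P : Measure S)
    (τ : ℝ) (p q : E) : Prop where
  gaussian : IsGaussianProcess (fun t : Icc (0 : ℝ) τ => B t) P
  continuous_paths : ∀ᵐ ω ∂P, ContinuousOn (fun t => B t ω) (Icc 0 τ)
  mean : ∀ t ∈ Icc (0 : ℝ) τ, ∫ ω, B t ω ∂P = p + (t / τ) • (q - p)
  covariance : ∀ s ∈ Icc (0 : ℝ) τ, ∀ t ∈ Icc (0 : ℝ) τ, s ≤ t → ∀ u v : E,
    cov[fun ω => inner ℝ u (B s ω), fun ω => inner ℝ v (B t ω); P] =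
      s * (τ - t) / τ * inner ℝ u v

/-- First time in `(0, τ]` at which the path of `B` lies in `A`. It is only used where almost every
path visits `A` during `(0, τ]`. -/
def firstTimeIn {E S : Type*} (B : ℝ → S → E) (τ : ℝ) (A : Set E) (ω : S) : ℝ :=
  sInf {t : ℝ | t ∈ Ioc 0 τ ∧ B t ω ∈ A}

/-- First passage time over the barrier `a`: `inf {t > 0 : B t > a}`. -/
def firstPassageTime {S : Type*} (B : ℝ → S → ℝ) (τ a : ℝ) : S → ℝ :=
  firstTimeIn B τ (Ioi a)

/-- First exit time from the domain `D`: `inf {t > 0 : B t ∉ D}`. -/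
def exitTime {E S : Type*} (B : ℝ → S → E) (τ : ℝ) (D : Set E) : S → ℝ :=
  firstTimeIn B τ Dᶜ

open Classical in
/-- Signed distance to the boundary of `D`: negative inside `D`, positive outside. -/
def boundarySignedDist {E : Type*} [PseudoMetricSpace E] (D : Set E) (y : E) : ℝ :=
  if y ∈ D then -Metric.infDist y (frontier D) else Metric.infDist y (frontier D)

/-- The open half-space with outer normal `ν`, bounded by the hyperplane `{y | ⟪ν, y⟫ = c}`. -/
def openHalfSpace {E : Type*} [NormedAddCommGroup E] [InnerProductSpace ℝ E] (ν : E) (c : ℝ) :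
    Set E :=
  {y | inner ℝ ν y < c}

/-- `Δρ = ρ(new) - ρ(old)`, the increment of the signed distance. -/
def deltaRho {E : Type*} [PseudoMetricSpace E] (D : Set E) (old new : E) : ℝ :=
  boundarySignedDist D new - boundarySignedDist D old

/-- `λ = |ρ(new)| / (|ρ(old)| + |ρ(new)|)`. -/
def exitWeight {E : Type*} [PseudoMetricSpace E] (D : Set E) (old new : E) : ℝ :=
  |boundarySignedDist D new| / (|boundarySignedDist D old| + |boundarySignedDist D new|)

end

/-!
For a Brownian bridge `B` from `0` to `x` over `[0, τ]` put `M = (x - B) / (τ - ·)` and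
`Y = 1 / (τ - ·)`. The process `M` is Gaussian with increments independent of the past, of variance
equal to the increment of `Y`; it is a Brownian motion run with the clock `Y`. Hence
`exp (θ M - θ² Y / 2)` is a martingale for every real `θ` (`IsBrownianBridge.lintegral_mul_bridgeExp`). Optional
stopping on a finite grid and Fatou's lemma along finer grids give, for the first passage time `T`
over `a` and any `t < τ`, that the expectation of this exponential at `T ∧ t` is at most its
initial value (`IsBrownianBridge.lintegral_bridgeExp_firstPassageTime_le`). With `δ = x - a`, one
has `M = δ Y` at time `T`.

* Upper bound. For `θ > 0` tending to `0`, the inequality becomes `δ 𝔼[1 / (τ - T ∧ t)] ≤ x / τ`,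
  and convexity of `y ↦ 1 / y` turns this into `𝔼[τ - T] ≥ δ τ / x`, that is, `𝔼[T] ≤ (a / x) τ`
  (`IsBrownianBridge.integral_firstPassageTime_le`).
* Lower bound. At `-θ` with `θ > 0` the inequality bounds the Laplace transform of `1 / (τ - T)` at
  `δ θ + θ² / 2` by `exp (-(x θ + θ² / 2) / τ)`. Integrating against `(δ + θ) dθ` yields `τ - T` on
  the left, by Tonelli's theorem. The integral on the right is a Mills ratio, and it is bounded by
  comparing the integrand with the derivative of `-(α + β θ) exp (-(x θ + θ² / 2) / τ)` for
  suitable `α` and `β` (`IsBrownianBridge.lintegral_sub_firstPassageTime_le`).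

A half-space reduces to dimension one: the signed distance travelled by the bridge in the normal
direction is a one-dimensional bridge (`IsBrownianBridge.inner_div_norm`), and the exit time is its
first passage time into a closed half-line `[a, ∞)`. This is the limit of the first passage times
over barriers increasing to `a`, which also covers an endpoint lying on the boundary
(`IsBrownianBridge.integral_firstTimeIn_Ici`). The asymptotic statements follow by squeezing.
-/

/-! ### Moments and independence for the one-dimensional bridge -/

namespace IsBrownianBridge

variable {S : Type*} [MeasurableSpace S] {P : Measure S} {B : ℝ → S → ℝ} {τ x : ℝ}

lemma aemeasurable (h : IsBrownianBridge B P τ 0 x) {t : ℝ} (ht : t ∈ Icc 0 τ) :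
    AEMeasurable (B t) P :=
  h.gaussian.aemeasurable ⟨t, ht⟩

lemma memLp_two (h : IsBrownianBridge B P τ 0 x) {t : ℝ} (ht : t ∈ Icc 0 τ) :
    MemLp (B t) 2 P :=
  (h.gaussian.hasGaussianLaw_eval ⟨t, ht⟩).memLp_two

lemma integral_eq (h : IsBrownianBridge B P τ 0 x) {t : ℝ} (ht : t ∈ Icc 0 τ) :
    ∫ ω, B t ω ∂P = t / τ * x := by
  simpa using h.mean t ht

lemma cov_eq (h : IsBrownianBridge B P τ 0 x) {s t : ℝ} (hs : s ∈ Icc 0 τ) (ht : t ∈ Icc 0 τ)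
    (hst : s ≤ t) : cov[B s, B t; P] = s * (τ - t) / τ := by
  simpa using h.covariance s hs t ht hst 1 1

lemma variance_eq (h : IsBrownianBridge B P τ 0 x) {t : ℝ} (ht : t ∈ Icc 0 τ) :
    Var[B t; P] = t * (τ - t) / τ := by
  rw [← covariance_self (h.aemeasurable ht), h.cov_eq ht ht le_rfl]

/-- Both endpoints of the bridge are almost surely equal to their means, their variances being
zero. -/
lemma ae_eq_of_variance_zero (h : IsBrownianBridge B P τ 0 x) {t : ℝ} (ht : t ∈ Icc 0 τ)
    (h0 : t * (τ - t) = 0) : ∀ᵐ ω ∂P, B t ω = t / τ * x := by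
  have := h.gaussian.isProbabilityMeasure
  have hv : evariance (B t) P = 0 := by
    rw [← (h.memLp_two ht).ofReal_variance_eq, h.variance_eq ht, h0]
    simp
  have := (evariance_eq_zero_iff (h.aemeasurable ht)).1 hv
  filter_upwards [this] with ω hω
  rw [hω, h.integral_eq ht]

lemma cov_increment_eq_zero (h : IsBrownianBridge B P τ 0 x) {u s t : ℝ} (hu : 0 ≤ u)
    (hus : u ≤ s) (hst : s ≤ t) (ht : t < τ) :
    cov[B u, fun ω => (τ - s)⁻¹ * B s ω - (τ - t)⁻¹ * B t ω; P] = 0 := by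
  have := h.gaussian.isProbabilityMeasure
  have hu' : u ∈ Icc 0 τ := ⟨hu, by linarith⟩
  have hs' : s ∈ Icc 0 τ := ⟨by linarith, by linarith⟩
  have ht' : t ∈ Icc 0 τ := ⟨by linarith, by linarith⟩
  rw [covariance_fun_sub_right (h.memLp_two hu') ((h.memLp_two hs').const_mul _)
    ((h.memLp_two ht').const_mul _), covariance_const_mul_right, covariance_const_mul_right,
    h.cov_eq hu' hs' hus, h.cov_eq hu' ht' (by linarith)]
  have h1 : τ - s ≠ 0 := by linarith
  have h2 : τ - t ≠ 0 := by linarith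
  field_simp
  ring

lemma variance_increment (h : IsBrownianBridge B P τ 0 x) {s t : ℝ} (hs : 0 ≤ s)
    (hst : s ≤ t) (ht : t < τ) :
    Var[fun ω => (τ - s)⁻¹ * B s ω - (τ - t)⁻¹ * B t ω; P] = (τ - t)⁻¹ - (τ - s)⁻¹ := by
  have := h.gaussian.isProbabilityMeasure
  have hs' : s ∈ Icc 0 τ := ⟨by linarith, by linarith⟩
  have ht' : t ∈ Icc 0 τ := ⟨by linarith, by linarith⟩
  rw [variance_fun_sub ((h.memLp_two hs').const_mul _)
    ((h.memLp_two ht').const_mul _), variance_const_mul, variance_const_mul,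
    covariance_const_mul_left, covariance_const_mul_right,
    h.cov_eq hs' ht' hst, h.variance_eq hs', h.variance_eq ht']
  have h1 : τ - s ≠ 0 := by linarith
  have h2 : τ - t ≠ 0 := by linarith
  have h3 : τ ≠ 0 := by linarith
  field_simp
  ring

lemma integral_increment (h : IsBrownianBridge B P τ 0 x) {s t : ℝ} (hs : 0 ≤ s)
    (hst : s ≤ t) (ht : t < τ) :
    ∫ ω, ((τ - s)⁻¹ * B s ω - (τ - t)⁻¹ * B t ω) ∂P = -(x * ((τ - t)⁻¹ - (τ - s)⁻¹)) := by
  have := h.gaussian.isProbabilityMeasure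
  have hs' : s ∈ Icc 0 τ := ⟨by linarith, by linarith⟩
  have ht' : t ∈ Icc 0 τ := ⟨by linarith, by linarith⟩
  rw [integral_sub (((h.memLp_two hs').integrable one_le_two).const_mul _)
    (((h.memLp_two ht').integrable one_le_two).const_mul _), integral_const_mul,
    integral_const_mul, h.integral_eq hs', h.integral_eq ht']
  have h1 : τ - s ≠ 0 := by linarith
  have h2 : τ - t ≠ 0 := by linarith
  have h3 : τ ≠ 0 := by linarith
  field_simp
  ring

end IsBrownianBridge

/-! ### The exponential martingale -/

/-- The exponential martingale `exp (θ Mₛ - θ² Yₛ / 2)` attached to a bridge ending at `x` at time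
`τ`, as a function of time `s` and of the position `y` of the bridge; here `M = (x - y) / (τ - s)`
and `Y = 1 / (τ - s)`. -/
noncomputable def bridgeExp (τ x θ s y : ℝ) : ℝ :=
  Real.exp (θ * ((x - y) * (τ - s)⁻¹) - θ ^ 2 / 2 * (τ - s)⁻¹)

lemma bridgeExp_pos (τ x θ s y : ℝ) : 0 < bridgeExp τ x θ s y := Real.exp_pos _

@[fun_prop]
lemma measurable_bridgeExp (τ x θ s : ℝ) : Measurable (bridgeExp τ x θ s) := by
  unfold bridgeExp
  fun_prop

namespace IsBrownianBridge

variable {S : Type*} [MeasurableSpace S] {P : Measure S} {B : ℝ → S → ℝ} {τ x : ℝ}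

/-- The bridge up to time `s` is independent of the increment over `[s, t]` of the martingale
`(x - B) / (τ - ·)`: the two are jointly Gaussian and uncorrelated. -/
lemma indepFun_increment (h : IsBrownianBridge B P τ 0 x) {ι : Type*} {u : ι → ℝ} {s t : ℝ}
    (hu : ∀ i, 0 ≤ u i) (hus : ∀ i, u i ≤ s) (hs : 0 ≤ s) (hst : s ≤ t) (ht : t < τ) :
    IndepFun (fun ω i => B (u i) ω) (fun ω => (τ - s)⁻¹ * B s ω - (τ - t)⁻¹ * B t ω) P := by
  classical
  have hs' : s ∈ Icc 0 τ := ⟨by linarith, by linarith⟩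
  have ht' : t ∈ Icc 0 τ := ⟨by linarith, by linarith⟩
  have hu' : ∀ i, u i ∈ Icc 0 τ := fun i => ⟨hu i, by linarith [hus i]⟩
  have key := IsGaussianProcess.indepFun_of_covariance_eq_zero (P := P)
    (X := fun i => B (u i))
    (Y := fun (_ : Unit) ω => (τ - s)⁻¹ * B s ω - (τ - t)⁻¹ * B t ω) ?_
    (fun i => h.aemeasurable (hu' i))
    (fun _ => ((h.aemeasurable hs').const_mul _).sub ((h.aemeasurable ht').const_mul _))
    (fun i _ => h.cov_increment_eq_zero (hu i) (hus i) hst ht)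
  · exact key.comp (φ := id) (ψ := fun f : Unit → ℝ => f ()) measurable_id (measurable_pi_apply _)
  · -- The joint finite-dimensional laws are linear images of those of the bridge.
    refine ⟨fun I => ?_⟩
    let J : Finset (Icc (0 : ℝ) τ) :=
      I.toLeft.image (fun i => ⟨u i, hu' i⟩) ∪ {⟨s, hs'⟩, ⟨t, ht'⟩}
    let L : (J → ℝ) →L[ℝ] (I → ℝ) := ContinuousLinearMap.pi fun k => match k with
      | ⟨.inl i, hk⟩ => ContinuousLinearMap.proj (⟨⟨u i, hu' i⟩, Finset.mem_union_left _
          (Finset.mem_image_of_mem _ (Finset.mem_toLeft.2 hk))⟩ : J)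
      | ⟨.inr _, _⟩ => (τ - s)⁻¹ • ContinuousLinearMap.proj (⟨⟨s, hs'⟩, by simp [J]⟩ : J) -
          (τ - t)⁻¹ • ContinuousLinearMap.proj (⟨⟨t, ht'⟩, by simp [J]⟩ : J)
    have hJ := (h.gaussian.hasGaussianLaw J).map_fun L
    convert! hJ using 1
    ext ω ⟨k, hk⟩
    rcases k with k | k <;> simp [L]

/-- The martingale property of `bridgeExp`, tested against a nonnegative function of the bridge
before time `s`. -/
lemma lintegral_mul_bridgeExp (h : IsBrownianBridge B P τ 0 x) {ι : Type*} [Countable ι]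
    {u : ι → ℝ} {s t : ℝ}
    (hu : ∀ i, 0 ≤ u i) (hus : ∀ i, u i ≤ s) (i₀ : ι) (hi₀ : u i₀ = s) (hst : s ≤ t)
    (ht : t < τ) (θ : ℝ) {G : (ι → ℝ) → ENNReal} (hG : Measurable G) :
    ∫⁻ ω, G (fun i => B (u i) ω) * ENNReal.ofReal (bridgeExp τ x θ t (B t ω)) ∂P =
      ∫⁻ ω, G (fun i => B (u i) ω) * ENNReal.ofReal (bridgeExp τ x θ s (B s ω)) ∂P := by
  have := h.gaussian.isProbabilityMeasure
  have hs : 0 ≤ s := hi₀ ▸ hu i₀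
  have hs' : s ∈ Icc 0 τ := ⟨by linarith, by linarith⟩
  have ht' : t ∈ Icc 0 τ := ⟨by linarith, by linarith⟩
  have hu' : ∀ i, u i ∈ Icc 0 τ := fun i => ⟨hu i, by linarith [hus i]⟩
  set D : S → ℝ := fun ω => (τ - s)⁻¹ * B s ω - (τ - t)⁻¹ * B t ω with hD
  set v : ℝ := (τ - t)⁻¹ - (τ - s)⁻¹ with hv
  have hv0 : 0 ≤ v := sub_nonneg.2 (inv_anti₀ (by linarith) (by linarith))
  set ξ : ℝ → ENNReal := fun d => ENNReal.ofReal (Real.exp (θ * (d + x * v) - θ ^ 2 / 2 * v))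
    with hξ
  have hξm : Measurable ξ := by fun_prop
  have hDm : AEMeasurable D P :=
    ((h.aemeasurable hs').const_mul _).sub ((h.aemeasurable ht').const_mul _)
  have hlaw : HasGaussianLaw D P := by
    have h2 := h.gaussian.hasGaussianLaw_prodMk (s := ⟨s, hs'⟩) (t := ⟨t, ht'⟩)
    simpa [hD] using! h2.map_fun ((τ - s)⁻¹ • ContinuousLinearMap.fst ℝ ℝ ℝ -
        (τ - t)⁻¹ • ContinuousLinearMap.snd ℝ ℝ ℝ)
  have hmap := hlaw.map_eq_gaussianReal
  have hone : ∫⁻ ω, ξ (D ω) ∂P = 1 := by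
    have hmgf := mgf_gaussianReal hmap θ
    rw [h.variance_increment hs hst ht, h.integral_increment hs hst ht,
      Real.coe_toNNReal _ hv0] at hmgf
    have hint : Integrable (fun ω => Real.exp (θ * D ω)) P := by
      have := integrable_exp_mul_gaussianReal (μ := P[D]) (v := Var[D; P].toNNReal) θ
      rw [← hmap] at this
      exact this.comp_aemeasurable hDm
    have hsplit : ∀ ω, Real.exp (θ * (D ω + x * v) - θ ^ 2 / 2 * v) =
        Real.exp (θ * D ω) * Real.exp (θ * (x * v) - θ ^ 2 / 2 * v) := fun ω => by
      rw [← Real.exp_add]; ring_nf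
    simp only [hξ, hsplit]
    rw [← ofReal_integral_eq_lintegral_ofReal (hint.mul_const _)
      (ae_of_all _ fun ω => by positivity), integral_mul_const]
    change ENNReal.ofReal (mgf D P θ * _) = 1
    rw [hmgf, ← Real.exp_add, ← ENNReal.ofReal_one, ← Real.exp_zero]
    congr 2
    ring
  have hind := h.indepFun_increment hu hus hs hst ht
  have hF : Measurable fun f : ι → ℝ => G f * ENNReal.ofReal (bridgeExp τ x θ s (f i₀)) := by
    fun_prop
  have hBm : AEMeasurable (fun ω i => B (u i) ω) P :=
    aemeasurable_pi_lambda _ fun i => h.aemeasurable (hu' i)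
  have hprod := lintegral_mul_eq_lintegral_mul_lintegral_of_indepFun''
    (hF.comp_aemeasurable hBm) (hξm.comp_aemeasurable hDm) (hind.comp hF hξm)
  simp only [Function.comp_apply, hone, mul_one, hi₀] at hprod
  rw [← hprod]
  refine lintegral_congr fun ω => ?_
  rw [mul_assoc, ← ENNReal.ofReal_mul (bridgeExp_pos ..).le, bridgeExp, bridgeExp, ← Real.exp_add]
  congr 3
  simp only [hD, hv]
  ring

end IsBrownianBridge

/-! ### First passage times along grids -/

open Classical in
/-- The first index `k` with `a < y k`, capped at `N`. -/
noncomputable def firstIndexAbove (a : ℝ) (N : ℕ) (y : ℕ → ℝ) : ℕ :=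
  Nat.find (⟨N, Or.inl le_rfl⟩ : ∃ k, N ≤ k ∨ a < y k)

lemma firstIndexAbove_eq_iff {a : ℝ} {N : ℕ} {y : ℕ → ℝ} {k : ℕ} :
    firstIndexAbove a N y = k ↔ (N ≤ k ∨ a < y k) ∧ ∀ i < k, ¬ (N ≤ i ∨ a < y i) := by
  classical
  exact Nat.find_eq_iff _

lemma firstIndexAbove_le_of_lt {a : ℝ} {N : ℕ} {y : ℕ → ℝ} {k : ℕ} (h : a < y k) :
    firstIndexAbove a N y ≤ k := by
  classical
  exact Nat.find_min' _ (Or.inr h)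

lemma firstIndexAbove_le (a : ℝ) (N : ℕ) (y : ℕ → ℝ) : firstIndexAbove a N y ≤ N := by
  classical
  exact Nat.find_min' _ (Or.inl le_rfl)

lemma firstIndexAbove_spec (a : ℝ) (N : ℕ) (y : ℕ → ℝ) :
    N ≤ firstIndexAbove a N y ∨ a < y (firstIndexAbove a N y) := by
  classical
  exact Nat.find_spec (⟨N, Or.inl le_rfl⟩ : ∃ k, N ≤ k ∨ a < y k)

@[fun_prop]
lemma measurable_firstIndexAbove (a : ℝ) (N : ℕ) : Measurable (firstIndexAbove a N) := by
  classical
  refine measurable_find _ fun k => ?_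
  exact (MeasurableSet.const _).union (measurableSet_lt measurable_const (measurable_pi_apply k))

/-- Whether the first index equals `k` is decided by the values up to index `k`. -/
lemma firstIndexAbove_min_eq_iff {a : ℝ} {N : ℕ} {y : ℕ → ℝ} {k : ℕ} :
    firstIndexAbove a N (fun i => y (min i k)) = k ↔ firstIndexAbove a N y = k := by
  simp only [firstIndexAbove_eq_iff, min_self]
  refine and_congr_right fun _ => forall₂_congr fun i hi => ?_
  rw [min_eq_left hi.le]

/-- The first of the times `t k / (n + 1)`, `k ≤ n`, at which the path `f` is above `a`, or `t` if
there is none. -/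
noncomputable def gridTime (a t : ℝ) (n : ℕ) (f : ℝ → ℝ) : ℝ :=
  t * firstIndexAbove a (n + 1) (fun k => f (t * k / (n + 1))) / (n + 1)

lemma gridTime_mem_Icc {t : ℝ} (ht : 0 ≤ t) (a : ℝ) (n : ℕ) (f : ℝ → ℝ) :
    gridTime a t n f ∈ Icc 0 t := by
  refine ⟨by unfold gridTime; positivity, ?_⟩
  have h1 : (firstIndexAbove a (n + 1) (fun k => f (t * k / (n + 1))) : ℝ) ≤ n + 1 :=
    mod_cast firstIndexAbove_le ..
  rw [gridTime, div_le_iff₀ (by positivity)]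
  exact mul_le_mul_of_nonneg_left h1 ht

lemma bddBelow_hitTimes (f : ℝ → ℝ) (τ : ℝ) (A : Set ℝ) :
    BddBelow {s : ℝ | s ∈ Ioc 0 τ ∧ f s ∈ A} := ⟨0, fun _ hs => hs.1.1.le⟩

/-- First passage times along finer and finer grids converge to the first passage time of a
continuous path into the open half-line. -/
lemma tendsto_gridTime {f : ℝ → ℝ} {τ a t : ℝ} (hf : ContinuousOn f (Icc 0 τ)) (h0 : f 0 ≤ a)
    (hτ : a < f τ) (ht : 0 < t) (htτ : t ≤ τ) :
    Tendsto (fun n => gridTime a t n f) atTop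
      (𝓝 (min (sInf {s : ℝ | s ∈ Ioc 0 τ ∧ f s ∈ Ioi a}) t)) := by
  have hne : {s : ℝ | s ∈ Ioc 0 τ ∧ f s ∈ Ioi a}.Nonempty :=
    ⟨τ, ⟨by linarith, le_rfl⟩, hτ⟩
  refine tendsto_order.2 ⟨fun b hb => Eventually.of_forall fun n => hb.trans_le ?_, fun b hb => ?_⟩
  · rcases firstIndexAbove_spec a (n + 1) (fun k => f (t * k / (n + 1))) with h | h
    · have he := le_antisymm (firstIndexAbove_le _ _ _) h
      refine (min_le_right _ _).trans ?_
      rw [gridTime, he, le_div_iff₀ (by positivity)]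
      push_cast
      exact le_rfl
    · refine (min_le_left _ _).trans (csInf_le (bddBelow_hitTimes f τ _) ?_)
      have hm := gridTime_mem_Icc ht.le a n f
      refine ⟨⟨lt_of_le_of_ne hm.1 fun h' => ?_, hm.2.trans htτ⟩, h⟩
      change a < f (gridTime a t n f) at h
      rw [← h'] at h
      linarith
  · rcases lt_or_ge t b with htb | hbt
    · exact Eventually.of_forall fun n => (gridTime_mem_Icc ht.le a n f).2.trans_lt htb
    obtain ⟨s, ⟨hs, hfs⟩, hsb⟩ := exists_lt_of_csInf_lt hne
      ((min_lt_iff.1 hb).resolve_right hbt.not_gt)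
    have hcont : ∀ᶠ r in 𝓝[Icc 0 τ] s, a < f r :=
      (hf s ⟨hs.1.le, hs.2⟩).eventually (lt_mem_nhds hfs)
    obtain ⟨ε, hε, hball⟩ := Metric.mem_nhdsWithin_iff.1 hcont
    have hlim : Tendsto (fun n : ℕ => t / ((n : ℝ) + 1)) atTop (𝓝 0) := by
      simpa [div_eq_mul_inv] using tendsto_one_div_add_atTop_nhds_zero_nat.const_mul t
    filter_upwards [hlim.eventually (gt_mem_nhds (lt_min hε (sub_pos.2 hsb)))] with n hn
    have hn1 : (0 : ℝ) < n + 1 := by positivity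
    set k : ℕ := ⌈s * (n + 1) / t⌉₊ with hk
    have hk1 : s ≤ t * k / (n + 1) := by
      rw [le_div_iff₀ hn1, mul_comm t, ← div_le_iff₀ ht]
      exact Nat.le_ceil _
    have hk2 : t * k / (n + 1) < s + t / (n + 1) := by
      have : (k : ℝ) < s * (n + 1) / t + 1 := Nat.ceil_lt_add_one (by have := hs.1; positivity)
      calc t * k / (n + 1) < t * (s * (n + 1) / t + 1) / (n + 1) := by gcongr
        _ = s + t / (n + 1) := by field_simp
    have hn2 := lt_min_iff.1 hn
    have hfk : a < f (t * k / (n + 1)) := by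
      refine hball ⟨?_, ?_, ?_⟩
      · rw [Metric.mem_ball, Real.dist_eq, abs_of_nonneg (by linarith)]
        linarith
      · linarith [hs.1]
      · linarith
    have hle : firstIndexAbove a (n + 1) (fun k => f (t * k / (n + 1))) ≤ k :=
      firstIndexAbove_le_of_lt hfk
    calc gridTime a t n f ≤ t * k / (n + 1) := by unfold gridTime; gcongr
      _ < b := by linarith

/-! ### Optional stopping of the exponential martingale -/

namespace IsBrownianBridge

variable {S : Type*} [MeasurableSpace S] {P : Measure S} {B : ℝ → S → ℝ} {τ x : ℝ}

/-- Optional stopping for `bridgeExp` along a finite grid of times. -/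
lemma lintegral_bridgeExp_firstIndexAbove (h : IsBrownianBridge B P τ 0 x) (hτ : 0 < τ)
    {u : ℕ → ℝ} (hu : Monotone u) (hu0 : u 0 = 0) {N : ℕ} (hN : u N < τ) (a θ : ℝ) :
    AEMeasurable (fun ω => ENNReal.ofReal (bridgeExp τ x θ
        (u (firstIndexAbove a N fun k => B (u k) ω))
        (B (u (firstIndexAbove a N fun k => B (u k) ω)) ω))) P ∧
      ∫⁻ ω, ENNReal.ofReal (bridgeExp τ x θ (u (firstIndexAbove a N fun k => B (u k) ω))
        (B (u (firstIndexAbove a N fun k => B (u k) ω)) ω)) ∂P =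
      ENNReal.ofReal (bridgeExp τ x θ 0 0) := by
  classical
  have := h.gaussian.isProbabilityMeasure
  have hnn : ∀ k, 0 ≤ u k := fun k => hu0 ▸ hu (Nat.zero_le k)
  have hmem : ∀ k ≤ N, u k ∈ Icc 0 τ := fun k hk => ⟨hnn k, (hu hk).trans hN.le⟩
  set G : ℕ → (ℕ → ℝ) → ENNReal := fun k => indicator (firstIndexAbove a N ⁻¹' {k}) 1 with hG
  have hGm : ∀ k, Measurable (G k) := fun k =>
    measurable_one.indicator (measurable_firstIndexAbove a N (measurableSet_singleton k))
  have hGB : ∀ k ω, G k (fun i => B (u (min i k)) ω) =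
      if firstIndexAbove a N (fun k => B (u k) ω) = k then 1 else 0 := fun k ω => by
    simp only [hG, indicator, mem_preimage, mem_singleton_iff, Pi.one_apply]
    exact if_congr (firstIndexAbove_min_eq_iff (y := fun i => B (u i) ω)) rfl rfl
  have hGam : ∀ k ≤ N, AEMeasurable (fun ω => G k (fun i => B (u (min i k)) ω)) P := fun k hk =>
    (hGm k).comp_aemeasurable
      (aemeasurable_pi_lambda _ fun i => h.aemeasurable (hmem _ ((min_le_right _ _).trans hk)))
  have hZm : ∀ k ≤ N,
      AEMeasurable (fun ω => ENNReal.ofReal (bridgeExp τ x θ (u k) (B (u k) ω))) P :=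
    fun k hk => ((measurable_bridgeExp τ x θ (u k)).comp_aemeasurable
      (h.aemeasurable (hmem k hk))).ennreal_ofReal
  -- On the event that the first index is `k`, the stopped value is the value at time `u k`.
  have hsum : ∀ ω, ENNReal.ofReal (bridgeExp τ x θ (u (firstIndexAbove a N fun k => B (u k) ω))
        (B (u (firstIndexAbove a N fun k => B (u k) ω)) ω)) =
      ∑ k ∈ Finset.range (N + 1), G k (fun i => B (u (min i k)) ω) *
        ENNReal.ofReal (bridgeExp τ x θ (u k) (B (u k) ω)) := fun ω => by
    simp only [hGB, ite_mul, one_mul, zero_mul]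
    rw [Finset.sum_ite_eq, if_pos]
    exact Finset.mem_range.2 (Nat.lt_succ_of_le (firstIndexAbove_le ..))
  have hone : ∀ ω, ∑ k ∈ Finset.range (N + 1), G k (fun i => B (u (min i k)) ω) = 1 := fun ω => by
    simp only [hGB]
    rw [Finset.sum_ite_eq, if_pos]
    exact Finset.mem_range.2 (Nat.lt_succ_of_le (firstIndexAbove_le ..))
  have hle : ∀ k ∈ Finset.range (N + 1), k ≤ N := fun k hk =>
    Nat.le_of_lt_succ (Finset.mem_range.1 hk)
  have htm : ∀ k ∈ Finset.range (N + 1), AEMeasurable (fun ω => G k (fun i => B (u (min i k)) ω) *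
        ENNReal.ofReal (bridgeExp τ x θ (u k) (B (u k) ω))) P :=
    fun k hk => (hGam k (hle k hk)).mul (hZm k (hle k hk))
  simp only [hsum]
  refine ⟨Finset.aemeasurable_fun_sum _ htm, ?_⟩
  rw [lintegral_finsetSum' _ htm]
  have hstep : ∀ k ∈ Finset.range (N + 1),
      ∫⁻ ω, G k (fun i => B (u (min i k)) ω) *
        ENNReal.ofReal (bridgeExp τ x θ (u k) (B (u k) ω)) ∂P =
      ∫⁻ ω, G k (fun i => B (u (min i k)) ω) *
        ENNReal.ofReal (bridgeExp τ x θ (u N) (B (u N) ω)) ∂P := fun k hk =>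
    (h.lintegral_mul_bridgeExp (u := fun i => u (min i k)) (fun i => hnn _)
      (fun i => hu (min_le_right _ _)) k (by simp) (hu (hle k hk)) hN θ (hGm k)).symm
  have hNm : ∀ k ∈ Finset.range (N + 1), AEMeasurable (fun ω => G k (fun i => B (u (min i k)) ω) *
        ENNReal.ofReal (bridgeExp τ x θ (u N) (B (u N) ω))) P :=
    fun k hk => (hGam k (hle k hk)).mul (hZm N le_rfl)
  rw [Finset.sum_congr rfl hstep, ← lintegral_finsetSum' _ hNm]
  simp only [← Finset.sum_mul, hone]
  rw [h.lintegral_mul_bridgeExp (ι := Unit) (u := fun _ => 0) (s := 0) (fun _ => le_rfl)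
    (fun _ => le_rfl) () rfl (hnn N) hN θ (G := fun _ => 1) measurable_const]
  have h0 := h.ae_eq_of_variance_zero (t := 0) ⟨le_rfl, hτ.le⟩ (by simp)
  rw [lintegral_congr_ae (g := fun _ => ENNReal.ofReal (bridgeExp τ x θ 0 0))]
  · simp
  · filter_upwards [h0] with ω hω
    rw [hω]
    simp

/-- Almost every path of the bridge is continuous, starts at `0` and ends at `x`. -/
lemma ae_path (h : IsBrownianBridge B P τ 0 x) (hτ : 0 < τ) :
    ∀ᵐ ω ∂P, ContinuousOn (fun t => B t ω) (Icc 0 τ) ∧ B 0 ω = 0 ∧ B τ ω = x := by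
  filter_upwards [h.continuous_paths, h.ae_eq_of_variance_zero (t := 0) ⟨le_rfl, hτ.le⟩ (by simp),
    h.ae_eq_of_variance_zero (t := τ) ⟨hτ.le, le_rfl⟩ (by simp)] with ω h1 h2 h3
  refine ⟨h1, by simpa using h2, ?_⟩
  rw [h3, div_self hτ.ne', one_mul]

lemma aemeasurable_gridTime (h : IsBrownianBridge B P τ 0 x) {t : ℝ} (ht : t ∈ Icc 0 τ) (a : ℝ)
    (n : ℕ) : AEMeasurable (fun ω => gridTime a t n fun s => B s ω) P := by
  -- Only the values at grid times in `[0, t]` matter, so the grid may be frozen at index `n + 1`.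
  have heq : ∀ ω, firstIndexAbove a (n + 1) (fun k => B (t * k / (n + 1)) ω) =
      firstIndexAbove a (n + 1) (fun k => B (t * (min k (n + 1) : ℕ) / (n + 1)) ω) := fun ω => by
    rw [firstIndexAbove_eq_iff]
    have hs := firstIndexAbove_eq_iff.1
      (rfl : firstIndexAbove a (n + 1) (fun k => B (t * (min k (n + 1) : ℕ) / (n + 1)) ω) = _)
    have hl := firstIndexAbove_le a (n + 1) (fun k => B (t * (min k (n + 1) : ℕ) / (n + 1)) ω)
    refine ⟨?_, fun i hi => ?_⟩
    · have := hs.1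
      rwa [min_eq_left hl] at this
    · have := hs.2 i hi
      rwa [min_eq_left (hi.le.trans hl)] at this
  unfold gridTime
  simp only [heq]
  have hm : AEMeasurable (fun ω =>
      firstIndexAbove a (n + 1) (fun k => B (t * (min k (n + 1) : ℕ) / (n + 1)) ω)) P := by
    refine (measurable_firstIndexAbove a (n + 1)).comp_aemeasurable
      (aemeasurable_pi_lambda _ fun k => h.aemeasurable ⟨?_, ?_⟩)
    · have := ht.1
      positivity
    · refine le_trans ?_ ht.2
      rw [div_le_iff₀ (by positivity)]
      refine mul_le_mul_of_nonneg_left ?_ ht.1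
      exact_mod_cast min_le_right k (n + 1)
  exact ((measurable_from_nat (f := fun k : ℕ => t * k / (n + 1))).comp_aemeasurable hm)

lemma aemeasurable_firstPassageTime (h : IsBrownianBridge B P τ 0 x) {a : ℝ} (hτ : 0 < τ)
    (ha : 0 ≤ a) (hax : a < x) : AEMeasurable (firstPassageTime B τ a) P := by
  have hlim : ∀ᵐ ω ∂P, Tendsto (fun n => gridTime a τ n fun s => B s ω) atTop
      (𝓝 (min (firstPassageTime B τ a ω) τ)) := by
    filter_upwards [h.ae_path hτ] with ω ⟨hc, h0, h1⟩
    exact tendsto_gridTime hc (by linarith) (by linarith) hτ le_rfl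
  refine (aemeasurable_of_tendsto_metrizable_ae atTop
    (fun n => h.aemeasurable_gridTime ⟨hτ.le, le_rfl⟩ a n) hlim).congr ?_
  filter_upwards [h.ae_path hτ] with ω ⟨hc, h0, h1⟩
  refine min_eq_left (csInf_le (bddBelow_hitTimes (fun s => B s ω) τ _) ⟨⟨hτ, le_rfl⟩, ?_⟩)
  rw [mem_Ioi, h1]
  exact hax

/-- Optional stopping for `bridgeExp` at the first passage time, as an inequality: Fatou's lemma
along the grids of `tendsto_gridTime`. The parameter `θ` may have either sign. -/
lemma lintegral_bridgeExp_firstPassageTime_le (h : IsBrownianBridge B P τ 0 x) {a t : ℝ}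
    (ha : 0 ≤ a) (hax : a < x) (ht : 0 < t) (htτ : t < τ) (θ : ℝ) :
    ∫⁻ ω, ENNReal.ofReal (bridgeExp τ x θ (min (firstPassageTime B τ a ω) t)
      (B (min (firstPassageTime B τ a ω) t) ω)) ∂P ≤ ENNReal.ofReal (bridgeExp τ x θ 0 0) := by
  have hτ : 0 < τ := ht.trans htτ
  set F : ℕ → S → ENNReal := fun n ω => ENNReal.ofReal (bridgeExp τ x θ
    (gridTime a t n fun s => B s ω) (B (gridTime a t n fun s => B s ω) ω)) with hF
  have key : ∀ n, AEMeasurable (F n) P ∧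
      ∫⁻ ω, F n ω ∂P = ENNReal.ofReal (bridgeExp τ x θ 0 0) := fun n =>
    h.lintegral_bridgeExp_firstIndexAbove hτ (u := fun k : ℕ => t * k / (n + 1)) (N := n + 1)
      (fun i j hij => by dsimp only; gcongr) (by simp) (by
        push_cast
        rwa [mul_div_assoc, div_self (by positivity), mul_one]) a θ
  calc _ ≤ ∫⁻ ω, liminf (fun n => F n ω) atTop ∂P := by
        refine lintegral_mono_ae ?_
        filter_upwards [h.ae_path hτ] with ω ⟨hc, h0, h1⟩
        have hlim : Tendsto (fun n => gridTime a t n fun s => B s ω) atTop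
            (𝓝 (min (firstPassageTime B τ a ω) t)) :=
          tendsto_gridTime hc (by linarith) (by linarith) ht htτ.le
        have hT0 : 0 ≤ firstPassageTime B τ a ω := Real.sInf_nonneg fun s hs => hs.1.1.le
        have hσ : min (firstPassageTime B τ a ω) t ∈ Icc 0 t :=
          ⟨le_min hT0 ht.le, min_le_right _ _⟩
        have hcont :
            ContinuousOn (fun s => ENNReal.ofReal (bridgeExp τ x θ s (B s ω))) (Icc 0 t) := by
          refine ENNReal.continuous_ofReal.comp_continuousOn ?_
          have hB : ContinuousOn (fun s => B s ω) (Icc 0 t) := hc.mono (Icc_subset_Icc_right htτ.le)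
          have hi : ContinuousOn (fun s : ℝ => (τ - s)⁻¹) (Icc 0 t) :=
            ContinuousOn.inv₀ (by fun_prop) fun s hs => by linarith [hs.2]
          unfold bridgeExp
          fun_prop
        refine le_of_eq (Tendsto.liminf_eq ?_).symm
        exact (hcont _ hσ).tendsto.comp (tendsto_nhdsWithin_iff.2
          ⟨hlim, Eventually.of_forall fun n => gridTime_mem_Icc ht.le a n _⟩)
    _ ≤ liminf (fun n => ∫⁻ ω, F n ω ∂P) atTop := lintegral_liminf_le' fun n => (key n).1
    _ = _ := by simp [(key _).2]

end IsBrownianBridge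

/-! ### Bounds on the expected first passage time -/

/-- An exact integral: the integrand is the derivative of
`-(α + β θ) exp (-(c θ + θ² / 2) Y)`. -/
lemma lintegral_Ioi_gaussian_primitive {c Y α β : ℝ} (hc : 0 < c) (hY : 0 < Y) (hα : 0 ≤ α)
    (hp : ∀ θ, 0 < θ → 0 ≤ (c + θ) * Y * (α + β * θ) - β) :
    ∫⁻ θ in Ioi 0, ENNReal.ofReal
      (((c + θ) * Y * (α + β * θ) - β) * Real.exp (-(c * θ + θ ^ 2 / 2) * Y)) =
      ENNReal.ofReal α := by
  set g : ℝ → ℝ := fun θ => -(α + β * θ) * Real.exp (-(c * θ + θ ^ 2 / 2) * Y) with hg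
  have hderiv : ∀ θ ∈ Ici (0 : ℝ), HasDerivAt g
      (((c + θ) * Y * (α + β * θ) - β) * Real.exp (-(c * θ + θ ^ 2 / 2) * Y)) θ := by
    intro θ _
    have h1 : HasDerivAt (fun θ : ℝ => -(α + β * θ)) (-β) θ := by
      have := (((hasDerivAt_id θ).const_mul β).const_add α).neg
      rwa [mul_one] at this
    have h2 : HasDerivAt (fun θ : ℝ => -(c * θ + θ ^ 2 / 2) * Y) (-(c + θ) * Y) θ := by
      have := (((hasDerivAt_id θ).const_mul c).add
        (((hasDerivAt_id θ).pow 2).div_const 2)).neg.mul_const Y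
      refine this.congr_deriv ?_
      simp
    refine (h1.mul h2.exp).congr_deriv ?_
    ring
  have hnn : ∀ θ ∈ Ioi (0 : ℝ),
      0 ≤ ((c + θ) * Y * (α + β * θ) - β) * Real.exp (-(c * θ + θ ^ 2 / 2) * Y) :=
    fun θ hθ => mul_nonneg (hp θ hθ) (Real.exp_pos _).le
  have hlim : Tendsto g atTop (𝓝 0) := by
    have hw : Tendsto (fun θ : ℝ => c * Y * θ) atTop atTop :=
      tendsto_id.const_mul_atTop (by positivity)
    have h0 := (Real.tendsto_pow_mul_exp_neg_atTop_nhds_zero 0).comp hw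
    have h1 := (Real.tendsto_pow_mul_exp_neg_atTop_nhds_zero 1).comp hw
    have hb := (h0.const_mul α).add (h1.const_mul (|β| / (c * Y)))
    simp only [mul_zero, add_zero] at hb
    refine squeeze_zero_norm' ?_ hb
    filter_upwards [eventually_ge_atTop (0 : ℝ)] with θ hθ
    have habs : |α + β * θ| ≤ α + |β| * θ := by
      calc |α + β * θ| ≤ |α| + |β * θ| := abs_add_le _ _
        _ = α + |β| * θ := by rw [abs_of_nonneg hα, abs_mul, abs_of_nonneg hθ]
    have hexp : Real.exp (-(c * θ + θ ^ 2 / 2) * Y) ≤ Real.exp (-(c * Y * θ)) := by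
      refine Real.exp_le_exp.2 ?_
      have : 0 ≤ θ ^ 2 / 2 * Y := by positivity
      linarith
    rw [hg, Real.norm_eq_abs, abs_mul, abs_neg, Real.abs_exp]
    calc |α + β * θ| * Real.exp (-(c * θ + θ ^ 2 / 2) * Y)
        ≤ (α + |β| * θ) * Real.exp (-(c * Y * θ)) := by gcongr
      _ = _ := by
        simp only [Function.comp_apply, pow_zero, pow_one]
        field_simp
  have hint := integrableOn_Ioi_deriv_of_nonneg' hderiv hnn hlim
  rw [← ofReal_integral_eq_lintegral_ofReal hint
    ((ae_restrict_iff' measurableSet_Ioi).2 (ae_of_all _ hnn)),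
    integral_Ioi_of_hasDerivAt_of_nonneg' hderiv hnn hlim]
  simp [hg]

/-- Up to its first passage time into `(a, ∞)` a continuous path stays below `a`. -/
lemma le_of_le_sInf_Ioi {f : ℝ → ℝ} {τ a : ℝ} (hf : ContinuousOn f (Icc 0 τ)) (h0 : f 0 ≤ a)
    (hτ : 0 < τ) (ha : a < f τ) {s : ℝ}
    (hs : s ∈ Icc 0 (sInf {s : ℝ | s ∈ Ioc 0 τ ∧ f s ∈ Ioi a})) : f s ≤ a := by
  set T := sInf {s : ℝ | s ∈ Ioc 0 τ ∧ f s ∈ Ioi a} with hT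
  have hTτ : T ≤ τ := csInf_le (bddBelow_hitTimes f τ _) ⟨⟨hτ, le_rfl⟩, ha⟩
  rcases (hs.1.trans hs.2).eq_or_lt with h | h
  · rw [← h, Icc_self, mem_singleton_iff] at hs
    rwa [hs]
  · have hcl : IsClosed (Icc 0 τ ∩ f ⁻¹' Iic a) := hf.preimage_isClosed_of_isClosed isClosed_Icc
      isClosed_Iic
    have hsub : Ico 0 T ⊆ Icc 0 τ ∩ f ⁻¹' Iic a := by
      intro r hr
      refine ⟨⟨hr.1, hr.2.le.trans hTτ⟩, ?_⟩
      rcases hr.1.eq_or_lt with h' | h'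
      · rw [← h']
        exact h0
      · by_contra hcon
        exact notMem_of_lt_csInf hr.2 (bddBelow_hitTimes f τ _)
          ⟨⟨h', hr.2.le.trans hTτ⟩, mem_Ioi.2 (not_le.1 hcon)⟩
    have := closure_minimal hsub hcl
    rw [closure_Ico h.ne] at this
    exact (this hs).2

lemma apply_sInf_Ioi {f : ℝ → ℝ} {τ a : ℝ} (hf : ContinuousOn f (Icc 0 τ)) (h0 : f 0 ≤ a)
    (hτ : 0 < τ) (ha : a < f τ) : f (sInf {s : ℝ | s ∈ Ioc 0 τ ∧ f s ∈ Ioi a}) = a := by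
  refine le_antisymm (le_of_le_sInf_Ioi hf h0 hτ ha
    ⟨Real.sInf_nonneg fun s hs => hs.1.1.le, le_rfl⟩) ?_
  have hcl : IsClosed (Icc 0 τ ∩ f ⁻¹' Ici a) := hf.preimage_isClosed_of_isClosed isClosed_Icc
    isClosed_Ici
  have hsub : {s : ℝ | s ∈ Ioc 0 τ ∧ f s ∈ Ioi a} ⊆ Icc 0 τ ∩ f ⁻¹' Ici a :=
    fun s hs => ⟨Ioc_subset_Icc_self hs.1, Ioi_subset_Ici_self hs.2⟩
  exact (closure_minimal hsub hcl (csInf_mem_closure ⟨τ, ⟨hτ, le_rfl⟩, ha⟩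
    (bddBelow_hitTimes f τ _))).2

lemma firstPassageTime_nonneg {S : Type*} {B : ℝ → S → ℝ} {τ a : ℝ} (ω : S) :
    0 ≤ firstPassageTime B τ a ω :=
  Real.sInf_nonneg fun _ hs => hs.1.1.le

namespace IsBrownianBridge

variable {S : Type*} [MeasurableSpace S] {P : Measure S} {B : ℝ → S → ℝ} {τ x a : ℝ}

lemma ae_firstPassageTime (h : IsBrownianBridge B P τ 0 x) (hτ : 0 < τ) (ha : 0 ≤ a)
    (hax : a < x) : ∀ᵐ ω ∂P, firstPassageTime B τ a ω ≤ τ ∧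
      B (firstPassageTime B τ a ω) ω = a ∧
      ∀ s ∈ Icc 0 (firstPassageTime B τ a ω), B s ω ≤ a := by
  filter_upwards [h.ae_path hτ] with ω ⟨hc, h0, h1⟩
  have h0' : B 0 ω ≤ a := by linarith
  have h1' : a < B τ ω := by linarith
  exact ⟨csInf_le (bddBelow_hitTimes (fun s => B s ω) τ _) ⟨⟨hτ, le_rfl⟩, h1'⟩,
    apply_sInf_Ioi (f := fun s => B s ω) hc h0' hτ h1',
    fun s hs => le_of_le_sInf_Ioi (f := fun s => B s ω) hc h0' hτ h1' hs⟩

lemma integrable_firstPassageTime (h : IsBrownianBridge B P τ 0 x) (hτ : 0 < τ) (ha : 0 ≤ a)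
    (hax : a < x) : Integrable (firstPassageTime B τ a) P := by
  have := h.gaussian.isProbabilityMeasure
  refine Integrable.of_mem_Icc 0 τ (h.aemeasurable_firstPassageTime hτ ha hax) ?_
  filter_upwards [h.ae_firstPassageTime hτ ha hax] with ω hω
  exact ⟨firstPassageTime_nonneg ω, hω.1⟩

/-- Letting `θ → 0+` in optional stopping for `bridgeExp` gives the inequality for the martingale
`(x - B) / (τ - ·)` stopped at `T ∧ t`, where `B ≤ a`. -/
lemma integral_inv_sub_firstPassageTime_le (h : IsBrownianBridge B P τ 0 x) {t : ℝ}
    (ha : 0 ≤ a) (hax : a < x) (ht : 0 < t) (htτ : t < τ) :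
    (x - a) * ∫ ω, (τ - min (firstPassageTime B τ a ω) t)⁻¹ ∂P ≤ x * τ⁻¹ := by
  have := h.gaussian.isProbabilityMeasure
  have hτ : 0 < τ := ht.trans htτ
  have hx : 0 < x := ha.trans_lt hax
  set Y : S → ℝ := fun ω => (τ - min (firstPassageTime B τ a ω) t)⁻¹ with hY
  have hYpos : ∀ ω, 0 < Y ω :=
    fun ω => inv_pos.2 (by linarith [min_le_right (firstPassageTime B τ a ω) t])
  have hYint : Integrable Y P := by
    refine Integrable.of_mem_Icc 0 (τ - t)⁻¹ ?_ (ae_of_all _ fun ω => ⟨(hYpos ω).le, ?_⟩)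
    · have := h.aemeasurable_firstPassageTime hτ ha hax
      fun_prop
    · exact inv_anti₀ (by linarith) (by linarith [min_le_right (firstPassageTime B τ a ω) t])
  set c := x * τ⁻¹ with hc
  have hc0 : 0 < c := by positivity
  have hδ : 0 < x - a := by linarith
  have key : ∀ θ, 0 < θ → θ < x - a → θ * c ≤ 1 →
      (x - a - θ / 2) * ∫ ω, Y ω ∂P ≤ c + θ * c ^ 2 := by
    intro θ hθ hθδ hθc
    have hle := h.lintegral_bridgeExp_firstPassageTime_le ha hax ht htτ θ
    have hlow : ∫⁻ ω, ENNReal.ofReal (1 + θ * (x - a - θ / 2) * Y ω) ∂P ≤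
        ENNReal.ofReal (bridgeExp τ x θ 0 0) := by
      refine (lintegral_mono_ae ?_).trans hle
      filter_upwards [h.ae_firstPassageTime hτ ha hax] with ω hω
      refine ENNReal.ofReal_le_ofReal ?_
      have hB : B (min (firstPassageTime B τ a ω) t) ω ≤ a :=
        hω.2.2 _ ⟨le_min (firstPassageTime_nonneg ω) ht.le, min_le_left _ _⟩
      refine le_trans ?_ (Real.add_one_le_exp _)
      have : θ * ((x - a) * Y ω) ≤ θ * ((x - B (min (firstPassageTime B τ a ω) t) ω) * Y ω) := by
        have := (hYpos ω).le
        gcongr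
      simp only [hY] at this ⊢
      linarith
    have hnn : ∀ ω, 0 ≤ 1 + θ * (x - a - θ / 2) * Y ω := fun ω => by
      have := hYpos ω
      have : 0 < x - a - θ / 2 := by linarith
      positivity
    have hi : Integrable (fun ω => 1 + θ * (x - a - θ / 2) * Y ω) P :=
      (integrable_const _).add (hYint.const_mul _)
    rw [← ofReal_integral_eq_lintegral_ofReal hi (ae_of_all _ hnn),
      ENNReal.ofReal_le_ofReal_iff (bridgeExp_pos ..).le,
      integral_add (integrable_const _) (hYint.const_mul _), integral_const_mul] at hlow
    simp only [integral_const, probReal_univ, smul_eq_mul, mul_one] at hlow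
    have hb : bridgeExp τ x θ 0 0 ≤ Real.exp (θ * c) := by
      unfold bridgeExp
      refine Real.exp_le_exp.2 ?_
      have : 0 ≤ θ ^ 2 / 2 * (τ - 0)⁻¹ := by rw [sub_zero]; positivity
      rw [sub_zero] at this
      simp only [sub_zero]
      linarith
    have he := (abs_le.1 (Real.abs_exp_sub_one_sub_id_le (x := θ * c)
      (by rw [abs_of_nonneg (by positivity)]; exact hθc))).2
    refine le_of_mul_le_mul_left ?_ hθ
    calc θ * ((x - a - θ / 2) * ∫ ω, Y ω ∂P) = θ * (x - a - θ / 2) * ∫ ω, Y ω ∂P := by ring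
      _ ≤ θ * (c + θ * c ^ 2) := by linarith
  have hl : Tendsto (fun θ : ℝ => (x - a - θ / 2) * ∫ ω, Y ω ∂P) (𝓝[>] 0)
      (𝓝 ((x - a) * ∫ ω, Y ω ∂P)) := by
    have : Continuous fun θ : ℝ => (x - a - θ / 2) * ∫ ω, Y ω ∂P := by fun_prop
    simpa using (this.tendsto 0).mono_left nhdsWithin_le_nhds
  have hr : Tendsto (fun θ : ℝ => c + θ * c ^ 2) (𝓝[>] 0) (𝓝 c) := by
    have : Continuous fun θ : ℝ => c + θ * c ^ 2 := by fun_prop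
    simpa using (this.tendsto 0).mono_left nhdsWithin_le_nhds
  refine le_of_tendsto_of_tendsto hl hr ?_
  filter_upwards [self_mem_nhdsWithin, Ioo_mem_nhdsGT (lt_min hδ (inv_pos.2 hc0))] with θ h1 h2
  refine key θ h1 (h2.2.trans_le (min_le_left _ _)) ?_
  have := (h2.2.trans_le (min_le_right _ _)).le
  rwa [← one_div, le_div_iff₀ hc0] at this

lemma integral_firstPassageTime_le (h : IsBrownianBridge B P τ 0 x) (hτ : 0 < τ) (ha : 0 ≤ a)
    (hax : a < x) : ∫ ω, firstPassageTime B τ a ω ∂P ≤ a / x * τ := by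
  have := h.gaussian.isProbabilityMeasure
  have hx : 0 < x := ha.trans_lt hax
  have hδ : 0 < x - a := by linarith
  have hTm := h.aemeasurable_firstPassageTime hτ ha hax
  have key : ∀ t, 0 < t → t < τ →
      ∫ ω, firstPassageTime B τ a ω ∂P ≤ a / x * τ + (τ - t) := by
    intro t ht htτ
    have hY := h.integral_inv_sub_firstPassageTime_le ha hax ht htτ
    set Y : S → ℝ := fun ω => (τ - min (firstPassageTime B τ a ω) t)⁻¹ with hYdef
    have hYpos : ∀ ω, 0 < Y ω :=
      fun ω => inv_pos.2 (by linarith [min_le_right (firstPassageTime B τ a ω) t])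
    have hYint : Integrable Y P := by
      refine Integrable.of_mem_Icc 0 (τ - t)⁻¹ (by fun_prop)
        (ae_of_all _ fun ω => ⟨(hYpos ω).le, ?_⟩)
      exact inv_anti₀ (by linarith) (by linarith [min_le_right (firstPassageTime B τ a ω) t])
    -- `c` is the value of `τ - T` that makes the tangent line of `y ↦ 1 / y` at `1 / c` sharp.
    set c := τ * (x - a) / x with hc
    have hc0 : 0 < c := by positivity
    have hpt : ∀ᵐ ω ∂P, firstPassageTime B τ a ω ≤ (τ - 2 * c + (τ - t)) + c ^ 2 * Y ω := by
      filter_upwards [h.ae_firstPassageTime hτ ha hax] with ω hω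
      have h1 : firstPassageTime B τ a ω ≤ min (firstPassageTime B τ a ω) t + (τ - t) := by
        rcases le_total (firstPassageTime B τ a ω) t with h' | h'
        · rw [min_eq_left h']; linarith
        · rw [min_eq_right h']; linarith [hω.1]
      have h2 : τ - min (firstPassageTime B τ a ω) t = (Y ω)⁻¹ := (inv_inv _).symm
      have h3 : 2 * c - c ^ 2 * Y ω ≤ (Y ω)⁻¹ := by
        have hy := hYpos ω
        rw [← sub_nonneg]
        have : (Y ω)⁻¹ - (2 * c - c ^ 2 * Y ω) = (1 - c * Y ω) ^ 2 * (Y ω)⁻¹ := by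
          field_simp
          ring
        rw [this]
        positivity
      linarith
    have hint := integral_mono_ae (h.integrable_firstPassageTime hτ ha hax)
      ((integrable_const _).add (hYint.const_mul _)) hpt
    simp only [Pi.add_apply] at hint
    rw [integral_add (integrable_const _) (hYint.const_mul _), integral_const_mul] at hint
    simp only [integral_const, probReal_univ, smul_eq_mul, one_mul] at hint
    have hcY : c ^ 2 * ∫ ω, Y ω ∂P ≤ c := by
      calc c ^ 2 * ∫ ω, Y ω ∂P = c * (τ / x) * ((x - a) * ∫ ω, Y ω ∂P) := by rw [hc]; ring
        _ ≤ c * (τ / x) * (x * τ⁻¹) := by gcongr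
        _ = c := by field_simp
    have : τ - c = a / x * τ := by rw [hc]; field_simp; ring
    linarith
  refine le_of_forall_pos_le_add fun ε hε => ?_
  have hm : 0 < min ε (τ / 2) := by positivity
  have := key (τ - min ε (τ / 2)) (by linarith [min_le_right ε (τ / 2)]) (by linarith)
  linarith [min_le_left ε (τ / 2)]

/-- Integrating the Laplace transform bounds of `1 / (τ - T)` over the parameter, with weight
`x - a + θ`, recovers `τ - T` on the left and a bound for the Mills ratio on the right. -/
lemma lintegral_sub_firstPassageTime_le (h : IsBrownianBridge B P τ 0 x) {t : ℝ}
    (ha : 0 ≤ a) (hax : a < x) (ht : 0 < t) (htτ : t < τ) :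
    ∫⁻ ω, {ω | firstPassageTime B τ a ω ≤ t}.indicator
      (fun ω => ENNReal.ofReal (τ - firstPassageTime B τ a ω)) ω ∂P ≤
      ENNReal.ofReal (τ - a * x * τ / (τ + x ^ 2)) := by
  have := h.gaussian.isProbabilityMeasure
  have hτ : 0 < τ := ht.trans htτ
  have hx : 0 < x := ha.trans_lt hax
  have hδ : 0 < x - a := by linarith
  set F : ℝ × ℝ → ENNReal := {p : ℝ × ℝ | p.1 ≤ t}.indicator fun p => ENNReal.ofReal
    ((x - a + p.2) * Real.exp (-((x - a) * p.2 + p.2 ^ 2 / 2) * (τ - p.1)⁻¹)) with hF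
  have hFm : Measurable F :=
    Measurable.indicator (by fun_prop) (measurableSet_le measurable_fst measurable_const)
  have hleft : ∀ ω, {ω | firstPassageTime B τ a ω ≤ t}.indicator
      (fun ω => ENNReal.ofReal (τ - firstPassageTime B τ a ω)) ω =
      ∫⁻ θ in Ioi 0, F (firstPassageTime B τ a ω, θ) := by
    intro ω
    by_cases hω : firstPassageTime B τ a ω ≤ t
    · have hd : 0 < τ - firstPassageTime B τ a ω := by linarith
      simp only [hF, indicator, mem_ofPred_eq, hω, if_true]
      rw [← lintegral_Ioi_gaussian_primitive hδ (inv_pos.2 hd) hd.le (β := 0)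
        fun θ hθ => by rw [zero_mul, add_zero, sub_zero]; positivity]
      refine lintegral_congr fun θ => ?_
      congr 2
      rw [zero_mul, add_zero, sub_zero, mul_assoc, inv_mul_cancel₀ hd.ne', mul_one]
    · simp [hF, hω]
  have hTm := h.aemeasurable_firstPassageTime hτ ha hax
  simp only [hleft]
  rw [lintegral_lintegral_swap (f := fun ω θ => F (firstPassageTime B τ a ω, θ))
    (hFm.comp_aemeasurable (hTm.comp_fst.prodMk measurable_snd.aemeasurable))]
  have hin : ∀ θ ∈ Ioi (0 : ℝ), ∫⁻ ω, F (firstPassageTime B τ a ω, θ) ∂P ≤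
      ENNReal.ofReal ((x - a + θ) * Real.exp (-(x * θ + θ ^ 2 / 2) * τ⁻¹)) := by
    intro θ hθ
    have hθ0 : 0 < θ := hθ
    have hw : 0 ≤ x - a + θ := by linarith
    have hle := h.lintegral_bridgeExp_firstPassageTime_le ha hax ht htτ (-θ)
    calc ∫⁻ ω, F (firstPassageTime B τ a ω, θ) ∂P
        ≤ ∫⁻ ω, ENNReal.ofReal (x - a + θ) * ENNReal.ofReal (bridgeExp τ x (-θ)
          (min (firstPassageTime B τ a ω) t) (B (min (firstPassageTime B τ a ω) t) ω)) ∂P := by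
          refine lintegral_mono_ae ?_
          filter_upwards [h.ae_firstPassageTime hτ ha hax] with ω hω
          by_cases hωt : firstPassageTime B τ a ω ≤ t
          · simp only [hF, indicator, mem_ofPred_eq, hωt, if_true]
            rw [min_eq_left hωt, hω.2.1, ← ENNReal.ofReal_mul hw, bridgeExp]
            refine le_of_eq ?_
            congr 3
            ring
          · simp [hF, hωt]
      _ ≤ ENNReal.ofReal (x - a + θ) * ENNReal.ofReal (bridgeExp τ x (-θ) 0 0) := by
          rw [lintegral_const_mul' _ _ ENNReal.ofReal_ne_top]
          gcongr
      _ = _ := by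
          rw [← ENNReal.ofReal_mul hw, bridgeExp]
          congr 3
          ring
  -- The coefficients solve `(α + β x) / τ = 1` and `α x / τ - β = x - a`.
  set α := τ - a * x * τ / (τ + x ^ 2) with hα
  set β := a * τ / (τ + x ^ 2) with hβ
  have hβ0 : 0 ≤ β := by positivity
  have hα0 : 0 ≤ α := by
    rw [hα, sub_nonneg, div_le_iff₀ (by positivity)]
    have : a * x ≤ x ^ 2 := by nlinarith
    nlinarith
  have hpoly : ∀ θ : ℝ, (x + θ) * τ⁻¹ * (α + β * θ) - β = x - a + θ + β * τ⁻¹ * θ ^ 2 := by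
    intro θ
    rw [hα, hβ]
    have : τ + x ^ 2 ≠ 0 := by positivity
    field_simp
    ring
  rw [← lintegral_Ioi_gaussian_primitive hx (inv_pos.2 hτ) hα0 (β := β)
    fun θ hθ => by rw [hpoly]; positivity]
  refine (setLIntegral_mono' measurableSet_Ioi hin).trans ?_
  refine setLIntegral_mono' measurableSet_Ioi fun θ hθ => ENNReal.ofReal_le_ofReal ?_
  rw [hpoly]
  have : 0 ≤ β * τ⁻¹ * θ ^ 2 := by positivity
  exact mul_le_mul_of_nonneg_right (by linarith) (Real.exp_pos _).le

lemma le_integral_firstPassageTime (h : IsBrownianBridge B P τ 0 x) (hτ : 0 < τ) (ha : 0 ≤ a)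
    (hax : a < x) : a * x * τ / (τ + x ^ 2) ≤ ∫ ω, firstPassageTime B τ a ω ∂P := by
  have := h.gaussian.isProbabilityMeasure
  have hx : 0 < x := ha.trans_lt hax
  have hTint := h.integrable_firstPassageTime hτ ha hax
  have hα0 : 0 ≤ τ - a * x * τ / (τ + x ^ 2) := by
    rw [sub_nonneg, div_le_iff₀ (by positivity)]
    have : a * x ≤ x ^ 2 := by nlinarith
    nlinarith
  have key : ∀ t, 0 < t → t < τ →
      a * x * τ / (τ + x ^ 2) ≤ ∫ ω, firstPassageTime B τ a ω ∂P + (τ - t) := by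
    intro t ht htτ
    have hle := h.lintegral_sub_firstPassageTime_le ha hax ht htτ
    have hsub : ∫⁻ ω, ENNReal.ofReal (τ - firstPassageTime B τ a ω) ∂P ≤
        ENNReal.ofReal (τ - a * x * τ / (τ + x ^ 2)) + ENNReal.ofReal (τ - t) := by
      calc ∫⁻ ω, ENNReal.ofReal (τ - firstPassageTime B τ a ω) ∂P
          ≤ ∫⁻ ω, ({ω | firstPassageTime B τ a ω ≤ t}.indicator
            (fun ω => ENNReal.ofReal (τ - firstPassageTime B τ a ω)) ω +
              ENNReal.ofReal (τ - t)) ∂P := by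
            refine lintegral_mono fun ω => ?_
            by_cases hω : firstPassageTime B τ a ω ≤ t
            · simp [hω]
            · simp only [indicator, mem_ofPred_eq, hω, if_false, zero_add]
              exact ENNReal.ofReal_le_ofReal (by linarith)
        _ ≤ _ := by
            rw [lintegral_add_right _ measurable_const]
            rw [lintegral_const, measure_univ, mul_one]
            gcongr
    have hnn : ∀ᵐ ω ∂P, 0 ≤ τ - firstPassageTime B τ a ω := by
      filter_upwards [h.ae_firstPassageTime hτ ha hax] with ω hω
      linarith [hω.1]
    have hi : Integrable (fun ω => τ - firstPassageTime B τ a ω) P := (integrable_const _).sub hTint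
    rw [← ofReal_integral_eq_lintegral_ofReal hi hnn,
      ← ENNReal.ofReal_add hα0 (by linarith), ENNReal.ofReal_le_ofReal_iff (by linarith),
      integral_sub (integrable_const _) hTint] at hsub
    simp only [integral_const, probReal_univ, smul_eq_mul, one_mul] at hsub
    linarith
  refine le_of_forall_pos_le_add fun ε hε => ?_
  have hm : 0 < min ε (τ / 2) := by positivity
  have := key (τ - min ε (τ / 2)) (by linarith [min_le_right ε (τ / 2)]) (by linarith)
  linarith [min_le_left ε (τ / 2)]

end IsBrownianBridge

/-! ### Closed half-lines -/

/-- The first passage time of a continuous path into `[a, ∞)` is the limit of its first passage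
times into `(bₖ, ∞)` for barriers `bₖ < a` tending to `a`. -/
lemma tendsto_sInf_Ioi_sInf_Ici {f : ℝ → ℝ} {τ a : ℝ} (hf : ContinuousOn f (Icc 0 τ))
    (h0 : f 0 < a) (hτ : 0 < τ) (ha : a ≤ f τ) {b : ℕ → ℝ} (hb : ∀ k, b k < a)
    (hlim : Tendsto b atTop (𝓝 a)) :
    Tendsto (fun k => sInf {s : ℝ | s ∈ Ioc 0 τ ∧ f s ∈ Ioi (b k)}) atTop
      (𝓝 (sInf {s : ℝ | s ∈ Ioc 0 τ ∧ f s ∈ Ici a})) := by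
  have hUτ : sInf {s : ℝ | s ∈ Ioc 0 τ ∧ f s ∈ Ici a} ≤ τ :=
    csInf_le (bddBelow_hitTimes f τ _) ⟨⟨hτ, le_rfl⟩, ha⟩
  refine tendsto_order.2 ⟨fun c hc => ?_, fun c hc => Eventually.of_forall fun k => ?_⟩
  · rcases lt_or_ge c 0 with hc0 | hc0
    · exact Eventually.of_forall fun k => hc0.trans_le (Real.sInf_nonneg fun s hs => hs.1.1.le)
    obtain ⟨c', hcc', hc'⟩ := exists_between hc
    -- The path stays strictly below `a` on the compact interval `[0, c']`.
    obtain ⟨m, hm, hmax⟩ := isCompact_Icc.exists_isMaxOn (nonempty_Icc.2 (hc0.trans hcc'.le))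
      (hf.mono (Icc_subset_Icc_right (hc'.le.trans hUτ)))
    have hfm : f m < a := by
      rcases hm.1.eq_or_lt with h | h
      · rwa [← h]
      · by_contra hcon
        exact notMem_of_lt_csInf (hm.2.trans_lt hc') (bddBelow_hitTimes f τ _)
          ⟨⟨h, hm.2.trans (hc'.le.trans hUτ)⟩, mem_Ici.2 (not_lt.1 hcon)⟩
    filter_upwards [hlim.eventually (lt_mem_nhds hfm)] with k hk
    refine hcc'.trans_le (le_csInf ⟨τ, ⟨hτ, le_rfl⟩, (hb k).trans_le ha⟩ fun s hs => ?_)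
    by_contra hcon
    have h1 : f s ≤ f m := hmax ⟨hs.1.1.le, (not_le.1 hcon).le⟩
    have h2 : b k < f s := hs.2
    linarith
  · refine lt_of_le_of_lt ?_ hc
    exact csInf_le_csInf (bddBelow_hitTimes f τ _) ⟨τ, ⟨hτ, le_rfl⟩, ha⟩
      fun s hs => ⟨hs.1, (hb k).trans_le hs.2⟩

namespace IsBrownianBridge

variable {S : Type*} [MeasurableSpace S] {P : Measure S} {B : ℝ → S → ℝ} {τ x a : ℝ}

/-- Bounds on the expected first passage time into the closed half-line; the barrier may be the
endpoint of the bridge. -/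
lemma integral_firstTimeIn_Ici (h : IsBrownianBridge B P τ 0 x) (hτ : 0 < τ) (ha : 0 < a)
    (hax : a ≤ x) : Integrable (firstTimeIn B τ (Ici a)) P ∧
      a * x * τ / (τ + x ^ 2) ≤ ∫ ω, firstTimeIn B τ (Ici a) ω ∂P ∧
      ∫ ω, firstTimeIn B τ (Ici a) ω ∂P ≤ a / x * τ := by
  have := h.gaussian.isProbabilityMeasure
  set b : ℕ → ℝ := fun k => a * (1 - 1 / ((k : ℝ) + 1)) with hb
  have hb0 : ∀ k, 0 ≤ b k := fun k => by
    refine mul_nonneg ha.le (sub_nonneg.2 ?_)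
    rw [div_le_one (by positivity)]
    linarith [(Nat.cast_nonneg k : (0 : ℝ) ≤ k)]
  have hba : ∀ k, b k < a := fun k => by
    have : 0 < a * (1 / ((k : ℝ) + 1)) := by positivity
    simp only [hb]
    linarith
  have hlim : Tendsto b atTop (𝓝 a) := by
    simpa [hb] using (tendsto_one_div_add_atTop_nhds_zero_nat (𝕜 := ℝ)).const_sub 1 |>.const_mul a
  have hbx : ∀ k, b k < x := fun k => (hba k).trans_le hax
  have hT : ∀ᵐ ω ∂P, Tendsto (fun k => firstPassageTime B τ (b k) ω) atTop
      (𝓝 (firstTimeIn B τ (Ici a) ω)) := by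
    filter_upwards [h.ae_path hτ] with ω ⟨hc, h0, h1⟩
    exact tendsto_sInf_Ioi_sInf_Ici (f := fun s => B s ω) hc (by linarith) hτ (by linarith)
      hba hlim
  have hm : ∀ k, AEMeasurable (firstPassageTime B τ (b k)) P := fun k =>
    h.aemeasurable_firstPassageTime hτ (hb0 k) (hbx k)
  have hUm := aemeasurable_of_tendsto_metrizable_ae atTop hm hT
  have hbound : ∀ k, ∀ᵐ ω ∂P, ‖firstPassageTime B τ (b k) ω‖ ≤ τ := fun k => by
    filter_upwards [h.ae_firstPassageTime hτ (hb0 k) (hbx k)] with ω hω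
    rw [Real.norm_eq_abs, abs_of_nonneg (firstPassageTime_nonneg ω)]
    exact hω.1
  have hint := tendsto_integral_of_dominated_convergence (fun _ => τ)
    (fun k => (hm k).aestronglyMeasurable) (integrable_const _) hbound hT
  refine ⟨Integrable.of_mem_Icc 0 τ hUm ?_, ?_, ?_⟩
  · filter_upwards [h.ae_path hτ] with ω ⟨hc, h0, h1⟩
    refine ⟨Real.sInf_nonneg fun s hs => hs.1.1.le,
      csInf_le (bddBelow_hitTimes (fun s => B s ω) τ _) ⟨⟨hτ, le_rfl⟩, ?_⟩⟩
    rw [mem_Ici, h1]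
    exact hax
  · refine le_of_tendsto_of_tendsto' (((hlim.mul_const x).mul_const τ).div_const (τ + x ^ 2)) hint
      fun k => h.le_integral_firstPassageTime hτ (hb0 k) (hbx k)
  · refine le_of_tendsto_of_tendsto' hint ((hlim.div_const x).mul_const τ)
      fun k => h.integral_firstPassageTime_le hτ (hb0 k) (hbx k)

end IsBrownianBridge

/-! ### Ratio form of the bounds -/

lemma ratio_bounds {τ a x m : ℝ} (hτ : 0 < τ) (ha : 0 < a) (hx : 0 < x)
    (h1 : a * x * τ / (τ + x ^ 2) ≤ m) (h2 : m ≤ a / x * τ) :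
    1 / (1 + τ / x ^ 2) ≤ m / (a / x * τ) ∧ m / (a / x * τ) ≤ 1 := by
  have hpos : 0 < a / x * τ := by positivity
  refine ⟨?_, (div_le_one hpos).2 h2⟩
  rw [le_div_iff₀ hpos]
  refine le_trans (le_of_eq ?_) h1
  field_simp
  ring

lemma tendsto_one_of_ratio_bounds {F : ℝ → ℝ} (x : ℝ)
    (h : ∀ τ, 0 < τ → 1 / (1 + τ / x ^ 2) ≤ F τ ∧ F τ ≤ 1) :
    Tendsto F (𝓝[>] 0) (𝓝 1) := by
  have hl : Tendsto (fun τ : ℝ => 1 / (1 + τ / x ^ 2)) (𝓝[>] 0) (𝓝 1) := by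
    have : ContinuousAt (fun τ : ℝ => 1 / (1 + τ / x ^ 2)) 0 :=
      ContinuousAt.div (by fun_prop) (by fun_prop) (by simp)
    simpa using this.tendsto.mono_left nhdsWithin_le_nhds
  refine tendsto_of_tendsto_of_tendsto_of_le_of_le' hl tendsto_const_nhds ?_ ?_
  · filter_upwards [self_mem_nhdsWithin] with τ hτ using (h τ hτ).1
  · filter_upwards [self_mem_nhdsWithin] with τ hτ using (h τ hτ).2

/-! ### Half-spaces -/

section HalfSpace

variable {E : Type*} [NormedAddCommGroup E] [InnerProductSpace ℝ E] {ν : E}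

lemma frontier_openHalfSpace (hν : ν ≠ 0) (c : ℝ) :
    frontier (openHalfSpace ν c) = {y | inner ℝ ν y = c} := by
  have hne : innerSL ℝ ν ≠ 0 := fun h => hν (by
    have := congrArg (fun f => f ν) h
    simpa using this)
  have := (ContinuousLinearMap.isOpenMap_of_ne_zero _ hne).preimage_frontier_eq_frontier_preimage
    (innerSL ℝ ν).continuous (Iio c)
  rw [frontier_Iio] at this
  exact this.symm

lemma infDist_frontier_openHalfSpace (hν : ν ≠ 0) (c : ℝ) (y : E) :
    Metric.infDist y (frontier (openHalfSpace ν c)) = |inner ℝ ν y - c| / ‖ν‖ := by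
  have hn : 0 < ‖ν‖ := norm_pos_iff.2 hν
  rw [frontier_openHalfSpace hν]
  -- The nearest point of the hyperplane is the orthogonal projection of `y`.
  set z : E := y - ((inner ℝ ν y - c) / ‖ν‖ ^ 2) • ν with hz
  have hzm : z ∈ {y : E | inner ℝ ν y = c} := by
    change inner ℝ ν z = c
    rw [hz, inner_sub_right, inner_smul_right, real_inner_self_eq_norm_sq]
    field_simp
    ring
  refine le_antisymm ?_ ((Metric.le_infDist ⟨z, hzm⟩).2 fun w hw => ?_)
  · refine (Metric.infDist_le_dist_of_mem hzm).trans (le_of_eq ?_)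
    rw [dist_eq_norm, hz, sub_sub_cancel, norm_smul, Real.norm_eq_abs, abs_div,
      abs_of_pos (pow_pos hn 2)]
    field_simp
  · have hw' : inner ℝ ν w = c := hw
    rw [div_le_iff₀ hn, ← hw', ← inner_sub_right, dist_eq_norm, mul_comm]
    exact abs_real_inner_le_norm ν (y - w)

lemma boundarySignedDist_openHalfSpace (hν : ν ≠ 0) (c : ℝ) (y : E) :
    boundarySignedDist (openHalfSpace ν c) y = (inner ℝ ν y - c) / ‖ν‖ := by
  unfold boundarySignedDist
  rw [infDist_frontier_openHalfSpace hν]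
  split_ifs with h
  · have h' : inner ℝ ν y < c := h
    rw [abs_of_neg (by linarith)]
    ring
  · have h' : c ≤ inner ℝ ν y := not_lt.1 h
    rw [abs_of_nonneg (by linarith)]

lemma deltaRho_openHalfSpace (hν : ν ≠ 0) (c : ℝ) (p q : E) :
    deltaRho (openHalfSpace ν c) p q = inner ℝ ν (q - p) / ‖ν‖ := by
  rw [deltaRho, boundarySignedDist_openHalfSpace hν, boundarySignedDist_openHalfSpace hν,
    inner_sub_right]
  ring

lemma one_sub_exitWeight_openHalfSpace (hν : ν ≠ 0) {c : ℝ} {p q : E}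
    (hp : p ∈ openHalfSpace ν c) (hq : q ∉ openHalfSpace ν c) :
    1 - exitWeight (openHalfSpace ν c) p q =
      ((c - inner ℝ ν p) / ‖ν‖) / deltaRho (openHalfSpace ν c) p q := by
  have hn : 0 < ‖ν‖ := norm_pos_iff.2 hν
  have hp' : inner ℝ ν p < c := hp
  have hq' : c ≤ inner ℝ ν q := not_lt.1 hq
  rw [exitWeight, deltaRho, boundarySignedDist_openHalfSpace hν,
    boundarySignedDist_openHalfSpace hν, abs_of_nonneg (div_nonneg (by linarith) hn.le),
    abs_of_neg (div_neg_of_neg_of_pos (by linarith) hn)]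
  have h1 : -((inner ℝ ν p - c) / ‖ν‖) + (inner ℝ ν q - c) / ‖ν‖ =
      (inner ℝ ν q - c) / ‖ν‖ - (inner ℝ ν p - c) / ‖ν‖ := by ring
  have h2 : (inner ℝ ν q - c) / ‖ν‖ - (inner ℝ ν p - c) / ‖ν‖ ≠ 0 := by
    rw [← sub_div]
    exact (div_pos (by linarith) hn).ne'
  rw [h1, eq_div_iff h2, sub_mul, div_mul_cancel₀ _ h2]
  ring

lemma exitTime_openHalfSpace {S : Type*} {B : ℝ → S → E} {τ : ℝ} (hν : ν ≠ 0) (c : ℝ) (p : E) :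
    exitTime B τ (openHalfSpace ν c) =
      firstTimeIn (fun t ω => inner ℝ ν (B t ω - p) / ‖ν‖) τ
        (Ici ((c - inner ℝ ν p) / ‖ν‖)) := by
  have hn : 0 < ‖ν‖ := norm_pos_iff.2 hν
  ext ω
  unfold exitTime firstTimeIn
  congr 1
  ext t
  refine and_congr_right fun _ => ?_
  change ¬ inner ℝ ν (B t ω) < c ↔ (c - inner ℝ ν p) / ‖ν‖ ≤ inner ℝ ν (B t ω - p) / ‖ν‖
  rw [div_le_div_iff_of_pos_right hn, inner_sub_right, not_lt, sub_le_sub_iff_right]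

variable [CompleteSpace E] [MeasurableSpace E] [BorelSpace E] [SecondCountableTopology E]
  {S : Type*} [MeasurableSpace S] {P : Measure S} {B : ℝ → S → E} {τ : ℝ} {p q : E}

/-- The signed distance travelled by a bridge in the direction of a nonzero vector is a
one-dimensional Brownian bridge started at `0`. -/
lemma IsBrownianBridge.inner_div_norm (h : IsBrownianBridge B P τ p q) (hν : ν ≠ 0) :
    IsBrownianBridge (fun t ω => inner ℝ ν (B t ω - p) / ‖ν‖) P τ 0
      (inner ℝ ν (q - p) / ‖ν‖) := by
  have := h.gaussian.isProbabilityMeasure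
  have hn : ‖ν‖ ≠ 0 := norm_ne_zero_iff.2 hν
  have hint : ∀ t ∈ Icc (0 : ℝ) τ, Integrable (B t) P := fun t ht =>
    (h.gaussian.hasGaussianLaw_eval ⟨t, ht⟩).integrable
  refine ⟨⟨fun I => ?_⟩, ?_, fun t ht => ?_, fun s hs t ht hst u v => ?_⟩
  · have hl := (h.gaussian.comp_left fun _ => (‖ν‖⁻¹ • innerSL ℝ ν : E →L[ℝ] ℝ)).hasGaussianLaw I
    have hlm := hl.aemeasurable
    have hl' := hl.isGaussian_map
    set c : I → ℝ := fun _ => ‖ν‖⁻¹ * inner ℝ ν p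
    have htr : IsGaussian ((P.map (fun ω => I.restrict fun t : Icc (0 : ℝ) τ =>
        (‖ν‖⁻¹ • innerSL ℝ ν : E →L[ℝ] ℝ) (B t ω))).map fun y => y - c) := inferInstance
    rw [AEMeasurable.map_map_of_aemeasurable (by fun_prop) hlm] at htr
    refine ⟨?_⟩
    convert! htr using 2
    ext ω i
    simp only [c, Finset.restrict, Function.comp_apply, Pi.sub_apply, inner_sub_right,
      smul_apply, innerSL_apply_apply, smul_eq_mul]
    ring
  · filter_upwards [h.continuous_paths] with ω hω
    fun_prop
  · have h1 : ∫ ω, inner ℝ ν (B t ω - p) / ‖ν‖ ∂P = inner ℝ ν (∫ ω, (B t ω - p) ∂P) / ‖ν‖ := by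
      rw [integral_div]
      congr 1
      exact (innerSL ℝ ν).integral_comp_comm ((hint t ht).sub (integrable_const _))
    rw [h1, integral_sub (hint t ht) (integrable_const _), h.mean t ht]
    simp only [integral_const, probReal_univ, one_smul, add_sub_cancel_left, inner_smul_right,
      smul_eq_mul, sub_zero, zero_add]
    ring
  · have hu : ∀ (u : ℝ) (r : ℝ), (fun ω => inner ℝ u (inner ℝ ν (B r ω - p) / ‖ν‖)) =
        fun ω => inner ℝ ((u / ‖ν‖) • ν) (B r ω) - u / ‖ν‖ * inner ℝ ν p := by
      intro u r
      ext ω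
      simp only [inner_sub_right, inner_smul_left, RCLike.inner_apply, conj_trivial]
      ring
    have hi : ∀ (u r : ℝ), r ∈ Icc 0 τ →
        Integrable (fun ω => inner ℝ ((u / ‖ν‖) • ν) (B r ω)) P := fun u r hr =>
      (innerSL ℝ ((u / ‖ν‖) • ν)).integrable_comp (hint r hr)
    rw [hu, hu, covariance_sub_const_left (hi u s hs), covariance_sub_const_right (hi v t ht),
      h.covariance s hs t ht hst]
    simp only [inner_smul_left, inner_smul_right, real_inner_self_eq_norm_sq, RCLike.inner_apply,
      conj_trivial]
    field_simp

lemma IsBrownianBridge.exitTime_bounds (h : IsBrownianBridge B P τ p q) (hτ : 0 < τ)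
    (hν : ν ≠ 0) {c : ℝ} (hp : p ∈ openHalfSpace ν c) (hq : q ∉ openHalfSpace ν c) :
    Integrable (exitTime B τ (openHalfSpace ν c)) P ∧
      1 / (1 + τ / deltaRho (openHalfSpace ν c) p q ^ 2) ≤
        (∫ ω, exitTime B τ (openHalfSpace ν c) ω ∂P) /
          ((1 - exitWeight (openHalfSpace ν c) p q) * τ) ∧
      (∫ ω, exitTime B τ (openHalfSpace ν c) ω ∂P) /
          ((1 - exitWeight (openHalfSpace ν c) p q) * τ) ≤ 1 := by
  have hn : 0 < ‖ν‖ := norm_pos_iff.2 hν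
  have hp' : inner ℝ ν p < c := hp
  have hq' : c ≤ inner ℝ ν q := not_lt.1 hq
  have ha : 0 < (c - inner ℝ ν p) / ‖ν‖ := div_pos (by linarith) hn
  have hax : (c - inner ℝ ν p) / ‖ν‖ ≤ inner ℝ ν (q - p) / ‖ν‖ := by
    rw [inner_sub_right]
    gcongr
  obtain ⟨h1, h2, h3⟩ := (h.inner_div_norm hν).integral_firstTimeIn_Ici hτ ha hax
  rw [one_sub_exitWeight_openHalfSpace hν hp hq, exitTime_openHalfSpace hν c p,
    deltaRho_openHalfSpace hν]
  exact ⟨h1, ratio_bounds hτ ha (ha.trans_le hax) h2 h3⟩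

end HalfSpace

/-! ### Bounds and asymptotics of expected hitting times -/

lemma IsBrownianBridge.firstPassageTime_bounds {S : Type*} [MeasurableSpace S] {P : Measure S}
    {B : ℝ → S → ℝ} {τ x a : ℝ} (h : IsBrownianBridge B P τ 0 x) (hτ : 0 < τ) (ha : 0 < a)
    (hax : a < x) :
    1 / (1 + τ / x ^ 2) ≤ (∫ ω, firstPassageTime B τ a ω ∂P) / (a / x * τ) ∧
      (∫ ω, firstPassageTime B τ a ω ∂P) / (a / x * τ) ≤ 1 :=
  ratio_bounds hτ ha (ha.trans hax) (h.le_integral_firstPassageTime hτ ha.le hax)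
    (h.integral_firstPassageTime_le hτ ha.le hax)

theorem mainTheorem4 :
    -- One-dimensional bridge from `0` to `x`, barrier `0 < a < x`.
    (∀ (S : Type*) [MeasurableSpace S] (P : Measure S) [IsProbabilityMeasure P]
        (B : ℝ → S → ℝ) (τ a x : ℝ), 0 < τ → 0 < a → a < x →
        IsBrownianBridge B P τ 0 x →
        Integrable (firstPassageTime B τ a) P ∧
        1 / (1 + τ / x ^ 2) ≤ (∫ ω, firstPassageTime B τ a ω ∂P) / (a / x * τ) ∧
        (∫ ω, firstPassageTime B τ a ω ∂P) / (a / x * τ) ≤ 1) ∧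
    -- The same quantity as the duration tends to zero.
    (∀ (S : ℝ → Type*) [∀ τ, MeasurableSpace (S τ)] (P : (τ : ℝ) → Measure (S τ))
        (B : (τ : ℝ) → ℝ → S τ → ℝ) (a x : ℝ),
        0 < a → a < x →
        (∀ τ, 0 < τ → IsBrownianBridge (B τ) (P τ) τ 0 x) →
        Tendsto (fun τ => (∫ ω, firstPassageTime (B τ) τ a ω ∂(P τ)) / (a / x * τ))
          (𝓝[>] 0) (𝓝 1)) ∧
    -- `d`-dimensional bridge from a point of a half-space to a point outside it.
    (∀ (d : ℕ) (S : Type*) [MeasurableSpace S] (P : Measure S) [IsProbabilityMeasure P]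
        (B : ℝ → S → EuclideanSpace ℝ (Fin d)) (τ : ℝ)
        (ν : EuclideanSpace ℝ (Fin d)) (c : ℝ) (old new : EuclideanSpace ℝ (Fin d)),
        0 < τ → ν ≠ 0 → old ∈ openHalfSpace ν c → new ∉ openHalfSpace ν c →
        IsBrownianBridge B P τ old new →
        Integrable (exitTime B τ (openHalfSpace ν c)) P ∧
        1 / (1 + τ / deltaRho (openHalfSpace ν c) old new ^ 2) ≤
          (∫ ω, exitTime B τ (openHalfSpace ν c) ω ∂P) /
            ((1 - exitWeight (openHalfSpace ν c) old new) * τ) ∧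
        (∫ ω, exitTime B τ (openHalfSpace ν c) ω ∂P) /
            ((1 - exitWeight (openHalfSpace ν c) old new) * τ) ≤ 1) ∧
    -- Asymptotics of the expected exit time as the duration tends to zero.
    (∀ (d : ℕ) (S : ℝ → Type*) [∀ τ, MeasurableSpace (S τ)] (P : (τ : ℝ) → Measure (S τ))
        (B : (τ : ℝ) → ℝ → S τ → EuclideanSpace ℝ (Fin d))
        (ν : EuclideanSpace ℝ (Fin d)) (c : ℝ) (old new : EuclideanSpace ℝ (Fin d)),
        ν ≠ 0 → old ∈ openHalfSpace ν c → new ∉ openHalfSpace ν c →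
        (∀ τ, 0 < τ → IsBrownianBridge (B τ) (P τ) τ old new) →
        Tendsto (fun τ => (∫ ω, exitTime (B τ) τ (openHalfSpace ν c) ω ∂(P τ)) /
            ((1 - exitWeight (openHalfSpace ν c) old new) * τ))
          (𝓝[>] 0) (𝓝 1)) := by
  refine ⟨?_, ?_, ?_, ?_⟩
  · intro S _ P _ B τ a x hτ ha hax h
    exact ⟨h.integrable_firstPassageTime hτ ha.le hax, h.firstPassageTime_bounds hτ ha hax⟩
  · intro S _ P B a x ha hax h
    exact tendsto_one_of_ratio_bounds x fun τ hτ => (h τ hτ).firstPassageTime_bounds hτ ha hax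
  · intro d S _ P _ B τ ν c p q hτ hν hp hq h
    exact h.exitTime_bounds hτ hν hp hq
  · intro d S _ P B ν c p q hν hp hq h
    exact tendsto_one_of_ratio_bounds (deltaRho (openHalfSpace ν c) p q) fun τ hτ =>
      ((h τ hτ).exitTime_bounds hτ hν hp hq).2
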